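/- Let $n$ be an odd positive integer, and let $$R=\mathbb{C}[x_1,\ldots,x_n]/(x_1^2,\ldots,x_n^2)^2,$$ graded by total degree, $R=\bigoplus_{i\ge 0}R_i$. Then $R$ has the Weak Lefschetz property: there exists a linear form $L\in R_1$ such that for every integer $i\ge 0$ the multiplication map $$\times L\colon R_i\to R_{i+1}$$ has maximal rank, i.e. is injective or surjective. -/

import Mathlib

/-- A linear map has maximal rank if it is injective or surjective. Between finite-dimensional
spaces this says that its rank is the smaller of the two dimensions, see
`hasMaximalRank_iff_finrank`. -/
def HasMaximalRank {K V W : Type*} [Field K] [AddCommGroup V] [Module K V] [AddCommGroup W]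
    [Module K W] (f : V →ₗ[K] W) : Prop :=
  Function.Injective f ∨ Function.Surjective f

theorem hasMaximalRank_iff_finrank {K V W : Type*} [Field K] [AddCommGroup V] [Module K V]
    [AddCommGroup W] [Module K W] [FiniteDimensional K V] [FiniteDimensional K W]
    (f : V →ₗ[K] W) :
    HasMaximalRank f ↔
      Module.finrank K (LinearMap.range f) = min (Module.finrank K V) (Module.finrank K W) := by
  have h1 := f.finrank_range_add_finrank_ker
  have h2 : Module.finrank K (LinearMap.range f) ≤ Module.finrank K W := Submodule.finrank_le _
  have h3 : Function.Injective f ↔ Module.finrank K (LinearMap.ker f) = 0 := by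
    rw [← LinearMap.ker_eq_bot, Submodule.finrank_eq_zero]
  have h4 : Function.Surjective f ↔
      Module.finrank K (LinearMap.range f) = Module.finrank K W := by
    rw [← LinearMap.range_eq_top]
    exact ⟨fun h => by rw [h, finrank_top], Submodule.eq_top_of_finrank_eq⟩
  unfold HasMaximalRank
  rw [h3, h4]
  omega

section Lefschetz

variable {K A : Type*} [Field K] [CommRing A] [Algebra K A]

/-- Multiplication by a linear form `L ∈ 𝒜 1` as a linear map `𝒜 i → 𝒜 (i + 1)`. -/
def mulLinearForm (𝒜 : ℕ → Submodule K A) [GradedAlgebra 𝒜] (L : 𝒜 1) (i : ℕ) :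
    𝒜 i →ₗ[K] 𝒜 (i + 1) :=
  ((LinearMap.mulLeft K (L : A)).domRestrict (𝒜 i)).codRestrict (𝒜 (i + 1)) fun x => by
    have h := SetLike.GradedMul.mul_mem L.2 x.2
    rwa [add_comm] at h

/-- The graded algebra `A = ⨁ 𝒜 i` has the Weak Lefschetz property: for some linear form `L`,
multiplication by `L` from degree `i` to degree `i + 1` has maximal rank for all `i`. -/
def HasWLP (𝒜 : ℕ → Submodule K A) [GradedAlgebra 𝒜] : Prop :=
  ∃ L : 𝒜 1, ∀ i : ℕ, HasMaximalRank (mulLinearForm 𝒜 L i)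

/-- The grading induced on the quotient `A ⧸ I`: the degree `i` part is the image of `𝒜 i`. -/
def quotientGrading (𝒜 : ℕ → Submodule K A) (I : Ideal A) (i : ℕ) : Submodule K (A ⧸ I) :=
  (𝒜 i).map (Ideal.Quotient.mkₐ K I).toLinearMap

/-- The graded pieces of a quotient multiply as they should. -/
theorem quotientGrading_gradedMonoid (𝒜 : ℕ → Submodule K A) [GradedAlgebra 𝒜] (I : Ideal A) :
    SetLike.GradedMonoid (quotientGrading 𝒜 I) where
  one_mem := ⟨1, SetLike.GradedOne.one_mem, map_one (Ideal.Quotient.mk I)⟩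
  mul_mem := by
    rintro i j _ _ ⟨a, ha, rfl⟩ ⟨b, hb, rfl⟩
    exact ⟨a * b, SetLike.GradedMul.mul_mem ha hb, map_mul (Ideal.Quotient.mk I) a b⟩

/-- The projection from the degree `i` part of `A` to the degree `i` part of `A ⧸ I`. -/
def toQuotientPiece (𝒜 : ℕ → Submodule K A) (I : Ideal A) (i : ℕ) :
    𝒜 i →ₗ[K] quotientGrading 𝒜 I i :=
  (Ideal.Quotient.mkₐ K I).toLinearMap.submoduleMap (𝒜 i)

/-- The linear map `A → ⨁ (A ⧸ I)_i` sending `a` to the family of classes of its homogeneous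
components. -/
noncomputable def toQuotientGrading (𝒜 : ℕ → Submodule K A) [GradedAlgebra 𝒜] (I : Ideal A) :
    A →ₗ[K] DirectSum ℕ (fun i => quotientGrading 𝒜 I i) :=
  (DirectSum.lmap (toQuotientPiece 𝒜 I)) ∘ₗ
    (DirectSum.decomposeLinearEquiv 𝒜).toLinearMap

theorem coe_toQuotientGrading_apply (𝒜 : ℕ → Submodule K A) [GradedAlgebra 𝒜] (I : Ideal A)
    (a : A) (i : ℕ) :
    (toQuotientGrading 𝒜 I a i : A ⧸ I) =
      Ideal.Quotient.mk I (DirectSum.decompose 𝒜 a i : A) := by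
  rfl

theorem quotientGrading_isInternal (𝒜 : ℕ → Submodule K A) [GradedAlgebra 𝒜] (I : Ideal A)
    (hI : I.IsHomogeneous 𝒜) : DirectSum.IsInternal (quotientGrading 𝒜 I) := by
  have hcomp : ∀ a, DirectSum.coeAddMonoidHom (quotientGrading 𝒜 I) (toQuotientGrading 𝒜 I a) =
      Ideal.Quotient.mk I a := by
    intro a
    induction a using DirectSum.Decomposition.inductionOn 𝒜 with
    | zero => simp
    | add a b ha hb => simp [ha, hb]
    | @homogeneous i m =>
      have : toQuotientGrading 𝒜 I (m : A) = DirectSum.of _ i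
          (toQuotientPiece 𝒜 I i m) := by
        simp only [toQuotientGrading, LinearMap.comp_apply]
        erw [DirectSum.decompose_coe]
        exact DirectSum.lmap_lof _ _ _
      rw [this, DirectSum.coeAddMonoidHom_of]
      rfl
  have hsurj : Function.Surjective (toQuotientGrading 𝒜 I) := by
    have h : Function.Surjective (DirectSum.lmap (toQuotientPiece 𝒜 I)) :=
      (DirectSum.lmap_surjective _).2 fun i => LinearMap.submoduleMap_surjective _ _
    exact h.comp (DirectSum.decompose 𝒜).surjective
  constructor
  · rw [injective_iff_map_eq_zero]
    intro y hy
    obtain ⟨a, rfl⟩ := hsurj y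
    rw [hcomp, Ideal.Quotient.eq_zero_iff_mem] at hy
    ext i
    rw [coe_toQuotientGrading_apply, Ideal.Quotient.eq_zero_iff_mem.2 (hI i hy)]
    rfl
  · intro y
    obtain ⟨a, rfl⟩ := Ideal.Quotient.mk_surjective y
    exact ⟨_, hcomp a⟩

/-- The quotient of a graded algebra by a homogeneous ideal is a graded algebra. -/
noncomputable abbrev quotientGradedAlgebra (𝒜 : ℕ → Submodule K A) [GradedAlgebra 𝒜]
    (I : Ideal A) (hI : I.IsHomogeneous 𝒜) : GradedAlgebra (quotientGrading 𝒜 I) :=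
  { quotientGrading_gradedMonoid 𝒜 I, (quotientGrading_isInternal 𝒜 I hI).chooseDecomposition with }

end Lefschetz

section Powers

/-- The ideal `(x_1^d, …, x_n^d)^k` of `ℂ[x_1, …, x_n]`. -/
noncomputable def powerIdeal (n d k : ℕ) : Ideal (MvPolynomial (Fin n) ℂ) :=
  Ideal.span (Set.range fun i : Fin n => (MvPolynomial.X i) ^ d) ^ k

/-- The standard grading of `ℂ[x_1, …, x_n]` by total degree. -/
noncomputable instance stdGradedAlgebra (n : ℕ) :
    GradedAlgebra (MvPolynomial.homogeneousSubmodule (Fin n) ℂ) :=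
  MvPolynomial.gradedAlgebra

theorem powerIdeal_isHomogeneous (n d k : ℕ) :
    (powerIdeal n d k).IsHomogeneous (MvPolynomial.homogeneousSubmodule (Fin n) ℂ) := by
  have h : (Ideal.span (Set.range fun i : Fin n => (MvPolynomial.X i : MvPolynomial (Fin n) ℂ) ^ d)
      ).IsHomogeneous (MvPolynomial.homogeneousSubmodule (Fin n) ℂ) := by
    apply Ideal.homogeneous_span
    rintro _ ⟨i, rfl⟩
    exact ⟨d, MvPolynomial.isHomogeneous_X_pow i d⟩
  unfold powerIdeal
  induction k with
  | zero =>
    rw [pow_zero, Ideal.one_eq_top]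
    exact Ideal.IsHomogeneous.top _
  | succ k ih =>
    rw [pow_succ]
    exact ih.mul h

/-- The degree `i` part of `ℂ[x_1, …, x_n] ⧸ (x_1^d, …, x_n^d)^k`: the classes of the forms of
degree `i`. -/
noncomputable def powerQuotientGrading (n d k : ℕ) :
    ℕ → Submodule ℂ (MvPolynomial (Fin n) ℂ ⧸ powerIdeal n d k) :=
  quotientGrading (MvPolynomial.homogeneousSubmodule (Fin n) ℂ) (powerIdeal n d k)

noncomputable instance powerQuotientGradedAlgebra (n d k : ℕ) :
    GradedAlgebra (powerQuotientGrading n d k) :=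
  quotientGradedAlgebra _ _ (powerIdeal_isHomogeneous n d k)

end Powers

/-! The monomials `x_S` and `x_S x_j ^ 2`, with `S` a set of variables, form a basis of `R`. A form
of degree `i` is thus a pair `(a, b)`: `a` squarefree of degree `i`, and each `b j` squarefree of
degree `i - 2`. Multiplication by `L = ∑ x_i` is triangular: `(a, b) ↦ (up a, up (b j) + pderiv j
a)`. By the `sl₂` relation `down_up`, `up` has the strong Lefschetz property on the squarefree
algebra.

Let `n = 2 m + 1`. Outside degree `m + 1`, the triangular shape reduces everything to injectivity or
surjectivity of `up`. In degree `m + 1`, `up a = 0` alone does not force `a = 0`. Summing over `j`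
gives `up (∑ b j) = - down a`, while `down_up` gives `a = up (down a)`. Hence `up ^ 3` kills `∑ b
j`, of degree `m - 1`, where it is injective. So `down a = 0` and `a = 0`. -/

/-! ### Lefschetz properties of the squarefree algebra -/

namespace SubsetLattice

variable {α : Type*} [Fintype α] [DecidableEq α]

set_option linter.unusedSectionVars false

/-- Functions on finite subsets supported on the subsets with `k` elements. -/
def level (α : Type*) (k : ℕ) : Submodule ℂ (Finset α → ℂ) where
  carrier := {a | ∀ S, a S ≠ 0 → S.card = k}
  zero_mem' := fun S h => absurd rfl h
  add_mem' := by
    intro a b ha hb S h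
    by_cases h1 : a S = 0
    · exact hb S (by simpa [h1] using h)
    · exact ha S h1
  smul_mem' := by
    intro c a ha S h
    exact ha S (right_ne_zero_of_mul h)

/-- The raising operator: multiplication by the sum of all variables in the squarefree algebra. -/
def up : Module.End ℂ (Finset α → ℂ) where
  toFun a S := ∑ i ∈ S, a (S.erase i)
  map_add' a b := by ext S; simp [Finset.sum_add_distrib]
  map_smul' c a := by ext S; simp [Finset.mul_sum]

/-- The derivative with respect to the variable `j` in the squarefree algebra. -/
def pderiv (j : α) : Module.End ℂ (Finset α → ℂ) where
  toFun a S := if j ∈ S then 0 else a (insert j S)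
  map_add' a b := by ext S; by_cases h : j ∈ S <;> simp [h]
  map_smul' c a := by ext S; by_cases h : j ∈ S <;> simp [h]

/-- The lowering operator. -/
def down : Module.End ℂ (Finset α → ℂ) := ∑ j, pderiv j

theorem up_apply (a : Finset α → ℂ) (S : Finset α) : up a S = ∑ i ∈ S, a (S.erase i) := rfl

theorem pderiv_apply (j : α) (a : Finset α → ℂ) (S : Finset α) :
    pderiv j a S = if j ∈ S then 0 else a (insert j S) := rfl

theorem down_apply (a : Finset α → ℂ) (S : Finset α) :
    down a S = ∑ j ∈ Sᶜ, a (insert j S) := by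
  simp only [down, LinearMap.sum_apply, Finset.sum_apply, pderiv_apply]
  rw [Finset.sum_ite, Finset.sum_const_zero, zero_add]
  congr 1
  ext; simp

theorem up_mem {k : ℕ} {a : Finset α → ℂ} (ha : a ∈ level α k) : up a ∈ level α (k + 1) := by
  intro S hS
  rw [up_apply] at hS
  obtain ⟨i, hi, h⟩ := Finset.exists_ne_zero_of_sum_ne_zero hS
  have := ha _ h
  rw [← Finset.card_erase_add_one hi, this]

theorem up_pow_mem {k : ℕ} {a : Finset α → ℂ} (ha : a ∈ level α k) (t : ℕ) :
    (up ^ t) a ∈ level α (k + t) := by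
  induction t with
  | zero => exact ha
  | succ t ih => rw [pow_succ', ← add_assoc]; exact up_mem ih

theorem pderiv_mem {k : ℕ} (j : α) {a : Finset α → ℂ} (ha : a ∈ level α (k + 1)) :
    pderiv j a ∈ level α k := by
  intro S hS
  rw [pderiv_apply] at hS
  split_ifs at hS with h
  · exact absurd rfl hS
  · have := ha _ hS
    rw [Finset.card_insert_of_notMem h] at this
    omega

theorem down_mem {k : ℕ} {a : Finset α → ℂ} (ha : a ∈ level α (k + 1)) : down a ∈ level α k := by
  rw [down, LinearMap.sum_apply]
  exact Submodule.sum_mem _ fun j _ => pderiv_mem j ha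

theorem down_eq_zero {a : Finset α → ℂ} (ha : a ∈ level α 0) : down a = 0 := by
  ext S
  rw [down_apply]
  refine Finset.sum_eq_zero fun j _ => ?_
  by_contra h
  simpa using ha _ h

theorem eq_zero_of_card_lt {k : ℕ} (hk : Fintype.card α < k) {a : Finset α → ℂ}
    (ha : a ∈ level α k) : a = 0 := by
  ext S
  by_contra h
  have := ha S h
  have := S.card_le_univ
  omega

/-- The terms exchanging some `i ∈ S` for some `j ∉ S` agree on both sides; the diagonal terms count
`Sᶜ` and `S`. -/
theorem down_up {k : ℕ} {a : Finset α → ℂ} (ha : a ∈ level α k) :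
    down (up a) = up (down a) + ((Fintype.card α : ℂ) - 2 * k) • a := by
  ext S
  have h1 : down (up a) S =
      (Fintype.card α - S.card : ℂ) * a S + ∑ j ∈ Sᶜ, ∑ i ∈ S, a (insert j (S.erase i)) := by
    rw [down_apply]
    have : ∀ j ∈ Sᶜ, up a (insert j S) = a S + ∑ i ∈ S, a (insert j (S.erase i)) := by
      intro j hj
      have hj : j ∉ S := by simpa using hj
      rw [up_apply, Finset.sum_insert hj, Finset.erase_insert hj]
      congr 1
      refine Finset.sum_congr rfl fun i hi => ?_
      rw [Finset.erase_insert_of_ne]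
      rintro rfl
      exact hj hi
    rw [Finset.sum_congr rfl this, Finset.sum_add_distrib, Finset.sum_const, Finset.card_compl,
      nsmul_eq_mul, Nat.cast_sub S.card_le_univ]
  have h2 : up (down a) S =
      (S.card : ℂ) * a S + ∑ j ∈ Sᶜ, ∑ i ∈ S, a (insert j (S.erase i)) := by
    rw [up_apply, Finset.sum_comm]
    have : ∀ i ∈ S, down a (S.erase i) = a S + ∑ j ∈ Sᶜ, a (insert j (S.erase i)) := by
      intro i hi
      rw [down_apply, Finset.compl_erase, Finset.sum_insert (by simpa using hi),
        Finset.insert_erase hi]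
    rw [Finset.sum_congr rfl this, Finset.sum_add_distrib, Finset.sum_const, nsmul_eq_mul]
  rw [Pi.add_apply, h1, h2, Pi.smul_apply, smul_eq_mul]
  by_cases h : a S = 0
  · simp [h]
  · rw [ha S h]
    ring

/-- The scalar is the sum of the weights `n - 2 (k + u)` over `0 ≤ u ≤ t`, where `n` is the
cardinality of `α`. -/
theorem down_up_pow {k : ℕ} {a : Finset α → ℂ} (ha : a ∈ level α k) (t : ℕ) :
    down ((up ^ (t + 1)) a) = (up ^ (t + 1)) (down a) +
      ((t + 1 : ℂ) * (Fintype.card α - 2 * k - t)) • (up ^ t) a := by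
  induction t with
  | zero => simpa using down_up ha
  | succ t ih =>
    rw [pow_succ' up (t + 1), Module.End.mul_apply, down_up (up_pow_mem ha _), ih, map_add,
      map_smul, ← Module.End.mul_apply up (up ^ (t + 1)), ← Module.End.mul_apply up (up ^ t),
      ← pow_succ', ← pow_succ', add_assoc, ← add_smul]
    congr 2
    push_cast
    ring

theorem eq_zero_of_up_pow_eq_zero_of_down {k : ℕ} {a : Finset α → ℂ} (ha : a ∈ level α k)
    (hd : down a = 0) (s : ℕ) (hs : s + 2 * k ≤ Fintype.card α) (h : (up ^ s) a = 0) : a = 0 := by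
  induction s with
  | zero => exact h
  | succ s ih =>
    refine ih (by omega) ?_
    have := down_up_pow ha s
    rw [h, hd, map_zero, map_zero, zero_add, eq_comm, smul_eq_zero] at this
    refine this.resolve_left (mul_ne_zero (by exact_mod_cast s.succ_ne_zero) ?_)
    have : ((Fintype.card α : ℤ) - 2 * k - s) ≠ 0 := by omega
    exact_mod_cast this

/-- The strong Lefschetz property of the squarefree algebra, injective half. -/
theorem eq_zero_of_up_pow_eq_zero {k : ℕ} {a : Finset α → ℂ} (ha : a ∈ level α k)
    (s : ℕ) (hs : s + 2 * k ≤ Fintype.card α) (h : (up ^ s) a = 0) : a = 0 := by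
  induction k generalizing a s with
  | zero => exact eq_zero_of_up_pow_eq_zero_of_down ha (down_eq_zero ha) s hs h
  | succ k ih =>
    obtain ⟨r, hr⟩ := Nat.exists_eq_add_of_le hs
    have hz : ∀ u, s ≤ u → (up ^ u) a = 0 := by
      intro u hu
      obtain ⟨v, rfl⟩ := Nat.exists_eq_add_of_le' hu
      rw [pow_add, Module.End.mul_apply, h, map_zero]
    refine eq_zero_of_up_pow_eq_zero_of_down ha ?_ s hs h
    -- The exponent `s + r + 2` equals `n - 2 k`, the largest allowed in level `k`.
    refine ih (down_mem ha) (s + r + 1 + 1) (by omega) ?_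
    have := down_up_pow ha (s + r + 1)
    rw [hz _ (by omega), hz _ (by omega), map_zero, smul_zero, add_zero] at this
    exact this.symm

theorem eq_zero_of_up_eq_zero {k : ℕ} {a : Finset α → ℂ} (ha : a ∈ level α k)
    (hk : 2 * k < Fintype.card α) (h : up a = 0) : a = 0 :=
  eq_zero_of_up_pow_eq_zero ha 1 (by omega) (by simpa using h)

/-- If `up ^ (t + 1)` kills `a`, commuting `down` past it shows that `up ^ t` kills `a + c⁻¹ • up
(down a)`, which differs from `a` by an element of the image of `up`. -/
theorem exists_up_eq_of_up_pow {k : ℕ} (hk : Fintype.card α < 2 * (k + 1)) (t : ℕ)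
    {a : Finset α → ℂ} (ha : a ∈ level α (k + 1)) (h : (up ^ t) a = 0) :
    ∃ b ∈ level α k, up b = a := by
  induction t generalizing a with
  | zero => exact ⟨0, zero_mem _, by rw [map_zero]; exact h.symm⟩
  | succ t ih =>
    set c : ℂ := (t + 1 : ℂ) * (Fintype.card α - 2 * (k + 1 : ℕ) - t) with hc
    have hc0 : c ≠ 0 := by
      refine mul_ne_zero (by exact_mod_cast t.succ_ne_zero) ?_
      have : ((Fintype.card α : ℤ) - 2 * (k + 1 : ℕ) - t) ≠ 0 := by omega
      exact_mod_cast this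
    have key := down_up_pow ha t
    rw [h, map_zero, ← hc] at key
    obtain ⟨b, hb, hba⟩ := ih (a := a + c⁻¹ • up (down a))
      (add_mem ha (Submodule.smul_mem _ _ (up_mem (down_mem ha)))) (by
        rw [map_add, map_smul, ← Module.End.mul_apply, ← pow_succ,
          eq_neg_of_add_eq_zero_left key.symm, smul_neg, smul_smul, inv_mul_cancel₀ hc0, one_smul,
          add_neg_cancel])
    refine ⟨b - c⁻¹ • down a, sub_mem hb (Submodule.smul_mem _ _ (down_mem ha)), ?_⟩
    rw [map_sub, map_smul, hba, add_sub_cancel_right]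

/-- The weak Lefschetz property of the squarefree algebra, surjective half. -/
theorem exists_up_eq {k : ℕ} (hk : Fintype.card α < 2 * (k + 1))
    {a : Finset α → ℂ} (ha : a ∈ level α (k + 1)) : ∃ b ∈ level α k, up b = a :=
  exists_up_eq_of_up_pow hk (Fintype.card α) ha
    (eq_zero_of_card_lt (by omega) (up_pow_mem ha _))

/-- In odd dimension `2 m + 1`, the pairs `(a, b)` of degree at most `m + 1` killed by the linear
form vanish. -/
theorem eq_zero_of_up_add_pderiv {m i : ℕ} (hm : Fintype.card α = 2 * m + 1) (hi : i ≤ m + 1)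
    {a : Finset α → ℂ} {b : α → Finset α → ℂ} (ha : a ∈ level α i)
    (hb : ∀ j S, b j S ≠ 0 → S.card + 2 = i) (hua : up a = 0)
    (hub : ∀ j, up (b j) + pderiv j a = 0) : a = 0 ∧ ∀ j, b j = 0 := by
  have hb0 (h : a = 0) (j : α) : b j = 0 := by
    have hj := hub j
    rw [h, map_zero, add_zero] at hj
    rcases lt_or_ge i 2 with h2 | h2
    · ext S
      by_contra hS
      have := hb j S hS
      omega
    · exact eq_zero_of_up_eq_zero (k := i - 2) (fun S hS => by have := hb j S hS; omega)
        (by omega) hj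
  suffices h : a = 0 from ⟨h, hb0 h⟩
  rcases hi.lt_or_eq with hi | rfl
  · exact eq_zero_of_up_eq_zero ha (by omega) hua
  have hsum : up (∑ j, b j) + down a = 0 := by
    rw [map_sum, down, LinearMap.sum_apply, ← Finset.sum_add_distrib]
    exact Finset.sum_eq_zero fun j _ => hub j
  have haU : a = up (down a) := by
    have := down_up ha
    rw [hua, map_zero, hm] at this
    have hc : ((2 * m + 1 : ℕ) : ℂ) - 2 * ((m + 1 : ℕ) : ℂ) = -1 := by push_cast; ring
    rw [hc, neg_smul, one_smul, ← sub_eq_add_neg, eq_comm, sub_eq_zero] at this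
    exact this.symm
  -- For `m = 0` no set has cardinality `-1`. Otherwise the exponent 3 is the extreme case `3 + 2 (m
  -- - 1) = n`.
  have hc : ∑ j, b j = 0 := by
    rcases m.eq_zero_or_pos with rfl | hm0
    · refine Finset.sum_eq_zero fun j _ => ?_
      ext S
      by_contra hS
      have := hb j S hS
      omega
    · refine eq_zero_of_up_pow_eq_zero (k := m - 1)
        (Submodule.sum_mem _ fun j _ S hS => ?_) 3 (by omega) ?_
      · have := hb j S hS
        omega
      · have : up (∑ j, b j) = - down a := eq_neg_of_add_eq_zero_left hsum
        simp only [pow_succ, pow_zero, one_mul, Module.End.mul_apply, this, map_neg, ← haU, hua,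
          neg_zero]
  rw [hc, map_zero, zero_add] at hsum
  rw [haU, hsum, map_zero]

/-- In odd dimension `2 m + 1`, the linear form maps onto the pairs of degree at least `m + 3`. -/
theorem exists_up_add_pderiv {m i : ℕ} (hm : Fintype.card α = 2 * m + 1) (hi : m ≤ i)
    {a : Finset α → ℂ} {b : α → Finset α → ℂ} (ha : a ∈ level α (i + 3))
    (hb : ∀ j, b j ∈ level α (i + 1)) :
    ∃ a' ∈ level α (i + 2), ∃ b' : α → Finset α → ℂ, (∀ j, b' j ∈ level α i) ∧
      up a' = a ∧ ∀ j, up (b' j) + pderiv j a' = b j := by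
  obtain ⟨a', ha', rfl⟩ := exists_up_eq (by omega) ha
  have (j : α) : ∃ c ∈ level α i, up c = b j - pderiv j a' :=
    exists_up_eq (by omega) (sub_mem (hb j) (pderiv_mem j ha'))
  choose b' hb' hub using this
  exact ⟨a', ha', b', hb', rfl, fun j => by rw [hub, sub_add_cancel]⟩

end SubsetLattice

/-! ### Standard monomials and multiplication by the sum of the variables -/

open SubsetLattice MvPolynomial

section Standard

variable {n : ℕ}

/-- The exponent of the monomial `x_S` (for `o = none`) or `x_S x_j ^ 2` (for `o = some j`). These
are the exponents of the monomials outside `(x_1 ^ 2, …, x_n ^ 2) ^ 2`. -/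
noncomputable def stdExponent (o : Option (Fin n)) (S : Finset (Fin n)) : Fin n →₀ ℕ :=
  Finsupp.equivFunOnFinite.symm fun i => (if i ∈ S then 1 else 0) + (if o = some i then 2 else 0)

theorem stdExponent_apply (o : Option (Fin n)) (S : Finset (Fin n)) (i : Fin n) :
    stdExponent o S i = (if i ∈ S then 1 else 0) + (if o = some i then 2 else 0) := rfl

theorem degree_stdExponent_none (S : Finset (Fin n)) : (stdExponent none S).degree = S.card := by
  simp [Finsupp.degree_eq_sum, stdExponent_apply]

theorem degree_stdExponent_some (j : Fin n) (S : Finset (Fin n)) :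
    (stdExponent (some j) S).degree = S.card + 2 := by
  simp [Finsupp.degree_eq_sum, stdExponent_apply, Finset.sum_add_distrib]

/-- Each exponent is at most 3: its parity detects `S`, and being at least 2 detects `o`. -/
theorem stdExponent_injective :
    Function.Injective fun x : Option (Fin n) × Finset (Fin n) => stdExponent x.1 x.2 := by
  rintro ⟨o, S⟩ ⟨o', S'⟩ h
  have h (i : Fin n) := DFunLike.congr_fun h i
  simp only [stdExponent_apply] at h
  have ho (i : Fin n) : o = some i ↔ o' = some i := by
    have := h i
    split_ifs at this <;> simp_all
  have hS (i : Fin n) : i ∈ S ↔ i ∈ S' := by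
    have := h i
    split_ifs at this <;> simp_all
  exact Prod.ext (Option.ext fun i => ho i) (Finset.ext hS)

theorem exists_stdExponent_eq {m : Fin n →₀ ℕ}
    (hm : ∀ i j, ¬ (Finsupp.single i 2 + Finsupp.single j 2 ≤ m)) :
    ∃ o S, stdExponent o S = m := by
  have h4 (i : Fin n) : m i < 4 := by
    by_contra h
    refine hm i i fun k => ?_
    rw [← Finsupp.single_add, Finsupp.single_apply]
    split_ifs with hk
    · subst hk; omega
    · exact Nat.zero_le _
  by_cases h : ∃ j, 2 ≤ m j
  · obtain ⟨j, hj⟩ := h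
    refine ⟨some j, Finset.univ.filter fun i => m i % 2 = 1, ?_⟩
    ext i
    simp only [stdExponent_apply, Finset.mem_filter, Finset.mem_univ, true_and, Option.some.injEq]
    have := h4 i
    by_cases hij : j = i
    · subst hij
      split_ifs <;> omega
    · have : m i < 2 := by
        by_contra h2
        refine hm i j fun k => ?_
        rw [Finsupp.add_apply, Finsupp.single_apply, Finsupp.single_apply]
        split_ifs with h1 h2 <;> subst_vars <;> omega
      split_ifs <;> omega
  · push Not at h
    refine ⟨none, Finset.univ.filter fun i => m i % 2 = 1, ?_⟩
    ext i
    have := h i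
    simp only [stdExponent_apply, Finset.mem_filter, Finset.mem_univ, true_and, reduceCtorEq]
    rw [if_neg not_false, add_zero]
    split_ifs <;> omega

theorem not_le_stdExponent (o : Option (Fin n)) (S : Finset (Fin n)) (i j : Fin n) :
    ¬ (Finsupp.single i 2 + Finsupp.single j 2 ≤ stdExponent o S) := by
  intro h
  have hi := h i
  have hj := h j
  simp only [Finsupp.add_apply, Finsupp.single_apply, stdExponent_apply] at hi hj
  by_cases hij : i = j
  · subst hij
    simp only [if_true] at hi
    split_ifs at hi <;> simp at hi
  · simp only [if_true, if_neg hij, if_neg (Ne.symm hij)] at hi hj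
    split_ifs at hi hj <;> simp_all

theorem powerIdeal_two_two (n : ℕ) : powerIdeal n 2 2 =
    Ideal.span ((fun s => monomial s (1 : ℂ)) ''
      Set.range fun x : Fin n × Fin n => Finsupp.single x.1 2 + Finsupp.single x.2 2) := by
  rw [powerIdeal, pow_two, Ideal.span_mul_span']
  congr 1
  ext p
  simp only [Set.mem_mul, Set.mem_range, Set.mem_image, exists_exists_eq_and, Prod.exists,
    X_pow_eq_monomial, monomial_mul, one_mul]
  constructor
  · rintro ⟨i, j, h⟩
    exact ⟨_, ⟨i, j, rfl⟩, h⟩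
  · rintro ⟨_, ⟨i, j, rfl⟩, h⟩
    exact ⟨i, j, h⟩

/-- The coefficients of the standard monomials `x_S` or `x_S x_j ^ 2`. -/
noncomputable def stdCoeff (o : Option (Fin n)) : MvPolynomial (Fin n) ℂ →ₗ[ℂ] (Finset (Fin n) → ℂ) :=
  LinearMap.pi fun S => lcoeff ℂ (stdExponent o S)

theorem stdCoeff_apply (o : Option (Fin n)) (p : MvPolynomial (Fin n) ℂ) (S : Finset (Fin n)) :
    stdCoeff o p S = coeff (stdExponent o S) p := rfl

theorem mem_powerIdeal_two_two {p : MvPolynomial (Fin n) ℂ} :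
    p ∈ powerIdeal n 2 2 ↔ ∀ o, stdCoeff o p = 0 := by
  rw [powerIdeal_two_two, mem_ideal_span_monomial_image]
  constructor
  · intro h o
    ext S
    by_contra hS
    obtain ⟨_, ⟨⟨i, j⟩, rfl⟩, hle⟩ := h _ (mem_support_iff.2 hS)
    exact not_le_stdExponent o S i j hle
  · intro h m hm
    by_contra! hcon
    obtain ⟨o, S, rfl⟩ := exists_stdExponent_eq fun i j => hcon _ ⟨(i, j), rfl⟩
    exact mem_support_iff.1 hm (congrFun (h o) S)

theorem stdCoeff_none_mem {i : ℕ} {p : MvPolynomial (Fin n) ℂ} (hp : p.IsHomogeneous i) :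
    stdCoeff none p ∈ level (Fin n) i := fun S hS => by
  rw [← degree_stdExponent_none]
  by_contra h
  exact hS (hp.coeff_eq_zero h)

theorem stdCoeff_some_mem {i : ℕ} {p : MvPolynomial (Fin n) ℂ} (hp : p.IsHomogeneous i)
    (j : Fin n) (S : Finset (Fin n)) (hS : stdCoeff (some j) p S ≠ 0) : S.card + 2 = i := by
  rw [← degree_stdExponent_some j]
  by_contra h
  exact hS (hp.coeff_eq_zero h)

theorem stdExponent_sub_single (o : Option (Fin n)) {S : Finset (Fin n)} {i : Fin n} (hi : i ∈ S) :
    stdExponent o S - Finsupp.single i 1 = stdExponent o (S.erase i) := by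
  ext k
  simp only [Finsupp.tsub_apply, stdExponent_apply, Finsupp.single_apply, Finset.mem_erase]
  by_cases h : i = k
  · subst h
    simp [hi]
  · simp [h, Ne.symm h]

theorem stdExponent_some_sub_single {S : Finset (Fin n)} {j : Fin n} (hj : j ∉ S) :
    stdExponent (some j) S - Finsupp.single j 1 = stdExponent none (insert j S) := by
  ext k
  simp only [Finsupp.tsub_apply, stdExponent_apply, Finsupp.single_apply, Finset.mem_insert]
  by_cases h : j = k
  · subst h
    simp [hj]
  · simp [h, Ne.symm h]

theorem stdCoeff_none_sum_X_mul (p : MvPolynomial (Fin n) ℂ) :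
    stdCoeff none ((∑ i, X i) * p) = up (stdCoeff none p) := by
  ext S
  rw [stdCoeff_apply, Finset.sum_mul, coeff_sum, up_apply]
  rw [← Finset.sum_subset (Finset.subset_univ S)]
  · refine Finset.sum_congr rfl fun i hi => ?_
    rw [coeff_X_mul', if_pos (by simp [stdExponent_apply, hi]), stdExponent_sub_single _ hi,
      stdCoeff_apply]
  · intro i _ hi
    rw [coeff_X_mul', if_neg (by simp [stdExponent_apply, hi])]

/-- If `j ∉ S`, dividing `x_S x_j ^ 2` by `x_j` leaves the squarefree monomial `x_S x_j`, whence the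
derivative term. If `j ∈ S`, it leaves `x_j ^ 2` times the product over `S.erase j`, already counted
by `up`. -/
theorem stdCoeff_some_sum_X_mul (j : Fin n) (p : MvPolynomial (Fin n) ℂ) :
    stdCoeff (some j) ((∑ i, X i) * p) =
      up (stdCoeff (some j) p) + SubsetLattice.pderiv j (stdCoeff none p) := by
  ext S
  rw [stdCoeff_apply, Finset.sum_mul, coeff_sum, Pi.add_apply, up_apply, pderiv_apply]
  have hS : ∑ i ∈ S, coeff (stdExponent (some j) S) (X i * p) =
      ∑ i ∈ S, stdCoeff (some j) p (S.erase i) := by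
    refine Finset.sum_congr rfl fun i hi => ?_
    rw [coeff_X_mul', if_pos (by simp [stdExponent_apply, hi]), stdExponent_sub_single _ hi,
      stdCoeff_apply]
  have h0 : ∀ i, i ∉ insert j S → coeff (stdExponent (some j) S) (X i * p) = 0 := by
    intro i hi
    rw [Finset.mem_insert, not_or] at hi
    rw [coeff_X_mul', if_neg (by simp [stdExponent_apply, hi, Ne.symm hi.1])]
  rw [← Finset.sum_subset (Finset.subset_univ (insert j S)) fun i _ hi => h0 i hi]
  split_ifs with hj
  · rw [Finset.insert_eq_self.2 hj, hS, add_zero]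
  · rw [Finset.sum_insert hj, hS, add_comm, coeff_X_mul',
      if_pos (by simp [stdExponent_apply]), stdExponent_some_sub_single hj, stdCoeff_apply]

/-- The combination of standard monomials with given coefficients. -/
noncomputable def ofStdCoeff (c : Option (Fin n) → Finset (Fin n) → ℂ) :
    MvPolynomial (Fin n) ℂ :=
  ∑ x : Option (Fin n) × Finset (Fin n), monomial (stdExponent x.1 x.2) (c x.1 x.2)

theorem stdCoeff_ofStdCoeff (c : Option (Fin n) → Finset (Fin n) → ℂ) (o : Option (Fin n)) :
    stdCoeff o (ofStdCoeff c) = c o := by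
  ext S
  rw [stdCoeff_apply, ofStdCoeff, coeff_sum, Finset.sum_eq_single (o, S)]
  · rw [coeff_monomial, if_pos rfl]
  · intro x _ hx
    rw [coeff_monomial, if_neg fun h => hx (stdExponent_injective h)]
  · exact fun h => absurd (Finset.mem_univ _) h

theorem isHomogeneous_ofStdCoeff {i : ℕ} {c : Option (Fin n) → Finset (Fin n) → ℂ}
    (h0 : c none ∈ level (Fin n) i) (h1 : ∀ j S, c (some j) S ≠ 0 → S.card + 2 = i) :
    (ofStdCoeff c).IsHomogeneous i := by
  refine IsHomogeneous.sum _ _ _ ?_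
  rintro ⟨o, S⟩ -
  by_cases h : c o S = 0
  · simp only [h, map_zero]
    exact isHomogeneous_zero _ _ _
  refine isHomogeneous_monomial _ ?_
  cases o with
  | none => rw [degree_stdExponent_none]; exact h0 S h
  | some j => rw [degree_stdExponent_some]; exact h1 j S h

theorem mem_powerQuotientGrading {d k i : ℕ} {x : MvPolynomial (Fin n) ℂ ⧸ powerIdeal n d k} :
    x ∈ powerQuotientGrading n d k i ↔
      ∃ p : MvPolynomial (Fin n) ℂ, p.IsHomogeneous i ∧ Ideal.Quotient.mk _ p = x :=
  Iff.rfl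

end Standard

theorem theorem3p8 (n : ℕ) (hn : Odd n) : HasWLP (powerQuotientGrading n 2 2) := by
  obtain ⟨m, hm⟩ := hn
  have hcard : Fintype.card (Fin n) = 2 * m + 1 := by rw [Fintype.card_fin, hm]
  refine ⟨⟨Ideal.Quotient.mk _ (∑ i, X i), mem_powerQuotientGrading.2
    ⟨_, IsHomogeneous.sum _ _ _ fun i _ => isHomogeneous_X ℂ i, rfl⟩⟩, fun i => ?_⟩
  -- Beyond `m + 1` the squarefree parts `b j` of the target have degree `i - 1 ≥ m + 1`, where `up`
  -- is onto.
  rcases le_or_gt i (m + 1) with hi | hi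
  · left
    rw [injective_iff_map_eq_zero]
    rintro ⟨x, hx⟩ h
    obtain ⟨p, hp, rfl⟩ := mem_powerQuotientGrading.1 hx
    have h : Ideal.Quotient.mk (powerIdeal n 2 2) ((∑ i, X i) * p) = 0 := congrArg Subtype.val h
    rw [Ideal.Quotient.eq_zero_iff_mem, mem_powerIdeal_two_two] at h
    obtain ⟨ha, hb⟩ := eq_zero_of_up_add_pderiv hcard hi (stdCoeff_none_mem hp)
      (stdCoeff_some_mem hp) (by rw [← stdCoeff_none_sum_X_mul, h])
      (fun j => by rw [← stdCoeff_some_sum_X_mul, h])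
    refine Subtype.ext (Ideal.Quotient.eq_zero_iff_mem.2 (mem_powerIdeal_two_two.2 fun o => ?_))
    cases o with
    | none => exact ha
    | some j => exact hb j
  · right
    rintro ⟨x, hx⟩
    obtain ⟨p, hp, rfl⟩ := mem_powerQuotientGrading.1 hx
    obtain ⟨i, rfl⟩ : ∃ k, i = k + 2 := ⟨i - 2, by omega⟩
    obtain ⟨a, ha, b, hb, hua, hub⟩ := exists_up_add_pderiv hcard (i := i) (by omega)
      (stdCoeff_none_mem hp) (b := fun j => stdCoeff (some j) p)
      (fun j S hS => by have := stdCoeff_some_mem hp j S hS; omega)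
    let c : Option (Fin n) → Finset (Fin n) → ℂ := fun o => o.elim a b
    have hc : (ofStdCoeff c).IsHomogeneous (i + 2) := isHomogeneous_ofStdCoeff ha
      fun j S hS => by rw [hb j S hS]
    refine ⟨⟨_, mem_powerQuotientGrading.2 ⟨_, hc, rfl⟩⟩, Subtype.ext ?_⟩
    change Ideal.Quotient.mk (powerIdeal n 2 2) ((∑ i, X i) * ofStdCoeff c) = _
    rw [Ideal.Quotient.eq, mem_powerIdeal_two_two]
    intro o
    rw [map_sub, sub_eq_zero]
    cases o with
    | none => rw [stdCoeff_none_sum_X_mul, stdCoeff_ofStdCoeff]; exact hua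
    | some j =>
      rw [stdCoeff_some_sum_X_mul, stdCoeff_ofStdCoeff, stdCoeff_ofStdCoeff]
      exact hub j
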